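/- Let $\Bbbk$ be a field and $N\ge 0$ an integer, and give $\mathbf Z^N$ the product partial order. A *$\mathbf Z^N$-persistence module* is a functor $M$ from the poset $\mathbf Z^N$ to $\Bbbk$-vector spaces; write $M_z$ for its component at $z$, and $M\langle z\rangle$ for the shift with $M\langle z\rangle_w=M_{z+w}$. For $z\in\mathbf Z^N$, let $F(z)$ be the module with $F(z)_v=\Bbbk$ if $z\le v$, $F(z)_v=0$ otherwise, and identities as structure maps between nonzero components. A module is *free of finite rank* if it is isomorphic to a finite direct sum $\bigoplus_{i=1}^n F(z_i)$. A module $M$ *eventually vanishes* if $\{z\in\mathbf Z^N : M_z\neq 0\}$ is bounded above in $\mathbf Z^N$. The *pointwise dual* $M^*$ has components $(M^*)_z=\operatorname{Hom}_\Bbbk(M_{-z},\Bbbk)$ and the transposes of the structure maps of $M$ as structure maps. The *global dual* $M^\dagger=\mathsf{Hom}(M,F(1,\dots,1))$ has components $(M^\dagger)_z=\operatorname{Hom}\bigl(M,F(1,\dots,1)\langle z\rangle\bigr)$, the vector space of morphisms of persistence modules, with structure maps induced by those of $F(1,\dots,1)$. Both duals are contravariant additive functors; in particular, applying $(-)^\dagger$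 degreewise to a chain complex $C$ gives a cochain complex $C^\dagger$. **Theorem.** Let $d\in\mathbf Z$. For all $\mathbf Z$-indexed chain complexes $C$ such that every $C_i$ is a free $\mathbf Z^N$-persistence module of finite rank and the modules $H_d(C),H_{d+1}(C),\dots,H_{d+N}(C)$ eventually vanish, there is an isomorphism of persistence modules $$H_d(C)^*\;\cong\;H^{d+N}(C^\dagger)$$ that is natural in $C$; that is, the two sides are isomorphic as contravariant functors on the full subcategory of all such chain complexes (with chain maps as morphisms). -/

import Mathlib

open CategoryTheory CategoryTheory.Limits

universe u

namespace Persistence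

/-- The poset `ℤ^N` of grades, with the product partial order and componentwise addition.
(A type of its own, so that its category structure is the one of the poset.) -/
def Grade (N : ℕ) : Type := Fin N → ℤ

instance (N : ℕ) : PartialOrder (Grade N) := inferInstanceAs (PartialOrder (Fin N → ℤ))

instance (N : ℕ) : AddCommGroup (Grade N) := inferInstanceAs (AddCommGroup (Fin N → ℤ))

instance (N : ℕ) : IsOrderedAddMonoid (Grade N) :=
  inferInstanceAs (IsOrderedAddMonoid (Fin N → ℤ))

/-- The vector `(1, …, 1)`. -/
instance (N : ℕ) : One (Grade N) := ⟨fun _ => (1 : ℤ)⟩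

/-- The category of `ℤ^N`-persistence modules over `k`: functors from the poset `ℤ^N` to
`k`-vector spaces. -/
abbrev Pers (k : Type u) [Field k] (N : ℕ) : Type (u + 1) := Grade N ⥤ ModuleCat.{u} k

variable {k : Type u} [Field k] {N : ℕ}

/-- `M` eventually vanishes if its support `{z | M_z ≠ 0}` is bounded above in `ℤ^N`. -/
def EventuallyVanishes (M : Pers k N) : Prop :=
  BddAbove {z : Grade N | Nontrivial (M.obj z)}

/-! ### Free modules -/

/-- The component of `F(z)` in grade `v`: all of `k` if `z ≤ v`, and `0` otherwise. -/
def freeComponent (k : Type u) [Field k] {N : ℕ} (z v : Grade N) : Submodule k k where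
  carrier := {c | ¬ z ≤ v → c = 0}
  add_mem' ha hb h := by rw [ha h, hb h, add_zero]
  zero_mem' _ := rfl
  smul_mem' c x hx h := by rw [hx h, smul_zero]

theorem freeComponent_mono (k : Type u) [Field k] {N : ℕ} (z : Grade N) {v w : Grade N}
    (h : v ≤ w) : freeComponent k z v ≤ freeComponent k z w :=
  fun _ hc hw => hc fun hv => hw (hv.trans h)

theorem freeComponent_of_le (k : Type u) [Field k] {N : ℕ} {z v : Grade N} (h : z ≤ v) :
    freeComponent k z v = ⊤ :=
  eq_top_iff.2 fun _ _ hn => absurd h hn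

theorem freeComponent_of_not_le (k : Type u) [Field k] {N : ℕ} {z v : Grade N} (h : ¬ z ≤ v) :
    freeComponent k z v = ⊥ :=
  eq_bot_iff.2 fun _ hc => (Submodule.mem_bot k).2 (hc h)

/-- The free module `F(z)` on one generator in grade `z`: it is `k` in the grades `v ≥ z` and `0`
in all others, and its structure maps between nonzero components are identities. -/
def free (k : Type u) [Field k] {N : ℕ} (z : Grade N) : Pers k N where
  obj v := ModuleCat.of k (freeComponent k z v)
  map f := ModuleCat.ofHom (Submodule.inclusion (freeComponent_mono k z (leOfHom f)))
  map_id _ := rfl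
  map_comp _ _ := rfl

/-- `M` is free of finite rank: it is isomorphic to the direct sum (that is, the coproduct)
`F(z₁) ⊕ ⋯ ⊕ F(zₙ)` for some finite list of grades `zᵢ`. -/
def IsFreeOfFiniteRank (M : Pers k N) : Prop :=
  ∃ (n : ℕ) (z : Fin n → Grade N), Nonempty ((∐ fun i => free k (z i)) ≅ M)

/-! ### The pointwise dual -/

/-- The pointwise dual `M^*`: `(M^*)_z = Hom_k(M_{-z}, k)`, with structure maps the transposes of
those of `M`. -/
def pointwiseDualObj (M : Pers k N) : Pers k N where
  obj z := ModuleCat.of k (Module.Dual k (M.obj (-z)))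
  map {z z'} f := ModuleCat.ofHom
    (M.map (homOfLE (neg_le_neg (leOfHom f)) : -z' ⟶ -z)).hom.dualMap
  map_id z := by
    refine ModuleCat.hom_ext (LinearMap.ext fun φ => LinearMap.ext fun x => ?_)
    exact congrArg (fun t : M.obj (-z) ⟶ M.obj (-z) => φ (t.hom x)) (M.map_id (-z))
  map_comp {x y z} f g := by
    refine ModuleCat.hom_ext (LinearMap.ext fun φ => LinearMap.ext fun m => ?_)
    exact congrArg (fun t : M.obj (-z) ⟶ M.obj (-x) => φ (t.hom m))
      (M.map_comp (homOfLE (neg_le_neg (leOfHom g)) : -z ⟶ -y)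
        (homOfLE (neg_le_neg (leOfHom f)) : -y ⟶ -x))

/-- The pointwise dual as a contravariant functor; a morphism is sent to its componentwise
transpose. -/
def pointwiseDual (k : Type u) [Field k] (N : ℕ) : (Pers k N)ᵒᵖ ⥤ Pers k N where
  obj M := pointwiseDualObj M.unop
  map {L M} f :=
    { app := fun z => ModuleCat.ofHom (f.unop.app (-z)).hom.dualMap
      naturality := fun z z' g => by
        refine ModuleCat.hom_ext (LinearMap.ext fun φ => LinearMap.ext fun m => ?_)
        exact congrArg (fun t : M.unop.obj (-z') ⟶ L.unop.obj (-z) =>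
            (show Module.Dual k (L.unop.obj (-z)) from φ) (t.hom m))
          (f.unop.naturality (homOfLE (neg_le_neg (leOfHom g)) : -z' ⟶ -z)).symm }
  map_id _ := rfl
  map_comp _ _ := rfl

/-! ### The global dual -/

/-- The shift `M⟨z⟩` with components `M⟨z⟩_w = M_{z+w}`. -/
def shift (z : Grade N) (M : Pers k N) : Pers k N where
  obj w := M.obj (z + w)
  map f := M.map (homOfLE (add_le_add_right (leOfHom f) z))
  map_id w := M.map_id (z + w)
  map_comp f g := M.map_comp (homOfLE (add_le_add_right (leOfHom f) z))
    (homOfLE (add_le_add_right (leOfHom g) z))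

/-- The morphism `M⟨z⟩ ⟶ M⟨z'⟩` for `z ≤ z'` that is given by the structure maps of `M`. -/
def shiftMap (M : Pers k N) {z z' : Grade N} (h : z ≤ z') : shift z M ⟶ shift z' M where
  app w := M.map (homOfLE (add_le_add_left h w))
  naturality _ _ _ := by
    simp only [shift, ← M.map_comp]
    rfl

/-- The persistence module `Hom(L, M)`, with components `Hom(L, M)_z = Hom(L, M⟨z⟩)` (the vector
space of all morphisms `L ⟶ M⟨z⟩`) and structure maps induced by those of `M`. -/
def internalHom (L M : Pers k N) : Pers k N where
  obj z := ModuleCat.of k (L ⟶ shift z M)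
  map f := ModuleCat.ofHom (Linear.rightComp k L (shiftMap M (leOfHom f)))
  map_id z := by
    ext φ
    have : shiftMap M (leOfHom (𝟙 z)) = 𝟙 (shift z M) := by
      ext w : 2
      exact M.map_id (z + w)
    simp [this]
  map_comp {x y z} f g := by
    ext φ
    have : shiftMap M (leOfHom (f ≫ g)) = shiftMap M (leOfHom f) ≫ shiftMap M (leOfHom g) := by
      ext w : 2
      exact M.map_comp (homOfLE (add_le_add_left (leOfHom f) w))
        (homOfLE (add_le_add_left (leOfHom g) w))
    simp [this]

/-- The global dual `M^† = Hom(M, F(1, …, 1))` as a contravariant functor; a morphism acts by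
precomposition. -/
def globalDual (k : Type u) [Field k] (N : ℕ) : (Pers k N)ᵒᵖ ⥤ Pers k N where
  obj M := internalHom M.unop (free k 1)
  map f :=
    { app := fun z => ModuleCat.ofHom (Linear.leftComp k (shift z (free k 1)) f.unop)
      naturality := fun _ _ g => ModuleCat.hom_ext (LinearMap.ext fun φ =>
        (Category.assoc f.unop φ (shiftMap (free k 1) (leOfHom g))).symm) }
  map_id M := by
    ext z : 2
    exact ModuleCat.hom_ext (LinearMap.ext fun φ => Category.id_comp (Y := shift z (free k 1)) φ)
  map_comp f g := by
    ext z : 2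
    exact ModuleCat.hom_ext (LinearMap.ext fun φ =>
      Category.assoc (Z := shift z (free k 1)) g.unop f.unop φ)

instance (k : Type u) [Field k] (N : ℕ) : (globalDual k N).Additive where
  map_add {_ _ f g} := by
    ext z : 2
    exact ModuleCat.hom_ext (LinearMap.ext fun φ =>
      Preadditive.add_comp _ _ (shift z (free k 1)) f.unop g.unop φ)

/-! ### Complexes -/

/-- A contravariant additive functor `G` on persistence modules, applied degreewise to a chain
complex `C`: the cochain complex with terms `G(C_i)` and coboundaries `G(∂)`. -/
def dualComplex (G : (Pers k N)ᵒᵖ ⥤ Pers k N) [G.Additive] :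
    (ChainComplex (Pers k N) ℤ)ᵒᵖ ⥤ CochainComplex (Pers k N) ℤ where
  obj C :=
    { X := fun i => G.obj (.op (C.unop.X i))
      d := fun i j => G.map (C.unop.d j i).op
      shape := fun i j h => by
        rw [C.unop.shape j i h, op_zero, G.map_zero]
      d_comp_d' := fun i j l _ _ => by
        rw [← G.map_comp, ← op_comp, C.unop.d_comp_d, op_zero, G.map_zero] }
  map f :=
    { f := fun i => G.map (f.unop.f i).op
      comm' := fun i j _ => by
        rw [← G.map_comp, ← G.map_comp, ← op_comp, ← op_comp, f.unop.comm] }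
  map_id C := by
    ext1 i
    exact G.map_id _
  map_comp f g := by
    ext1 i
    exact G.map_comp (f.unop.f i).op (g.unop.f i).op

/-- The chain complexes `C` (indexed by all integers) of finite rank free modules such that
`H_d(C), …, H_{d+N}(C)` eventually vanish. -/
def IsAdmissible (k : Type u) [Field k] (N : ℕ) (d : ℤ) :
    ObjectProperty (ChainComplex (Pers k N) ℤ) := fun C =>
  (∀ i : ℤ, IsFreeOfFiniteRank (C.X i)) ∧
    ∀ j : ℤ, d ≤ j → j ≤ d + N → EventuallyVanishes (C.homology j)

/-- The functor `C ↦ H_d(C)^*` on the full subcategory of admissible chain complexes. -/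
noncomputable def dualOfHomology (k : Type u) [Field k] (N : ℕ) (d : ℤ) :
    (IsAdmissible k N d).FullSubcategoryᵒᵖ ⥤ Pers k N :=
  (IsAdmissible k N d).ι.op ⋙
    (HomologicalComplex.homologyFunctor (Pers k N) (ComplexShape.down ℤ) d).op ⋙
      pointwiseDual k N

/-- The functor `C ↦ H^{d+N}(C^†)` on the full subcategory of admissible chain complexes. -/
noncomputable def cohomologyOfGlobalDual (k : Type u) [Field k] (N : ℕ) (d : ℤ) :
    (IsAdmissible k N d).FullSubcategoryᵒᵖ ⥤ Pers k N :=
  (IsAdmissible k N d).ι.op ⋙ dualComplex (globalDual k N) ⋙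
    HomologicalComplex.homologyFunctor (Pers k N) (ComplexShape.up ℤ) (d + N)

end Persistence

namespace Persistence

variable {k : Type u} [Field k] {N : ℕ}

/-! ### Exactness in functor categories -/

/-! Both duals are functors of morphisms into indicator modules of boxes. Linear forms on `M_{-z}`
are morphisms from `M` to the indicator module of `{v | v ≤ -z}` (sign vector constantly `1`), and
`F(1,…,1)⟨z⟩` is the indicator module of `{v | v i > -z i for all i}` (sign vector constantly `-1`).
Exactness of vector space duality identifies `H_d(C)^*` with the degree `d` cohomology of the
morphisms from `C` into the first family.

The passage between the families flips one coordinate at a time. A box that is unrestricted in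
coordinate `i` is an extension of its part with `v i ≤ -z i` by its part with `v i > -z i`. As the
terms of `C` are projective, this gives a long exact cohomology sequence, natural in `C`, whose
connecting map raises the degree by one. It is an isomorphism where the cohomology of the middle
term vanishes, and `N` flips lead from degree `d` to degree `d + N`.

The vanishing (`isZero_extFunctor_of_isAdmissible`) is an induction on the number of entries `-1`.
Without such entries, the box is a lower set unbounded in some direction; finite rank allows it to
be cut off at a far grade `t`, where the homology of `C` is zero
(`isZero_extFunctor_of_ne_neg_one`). -/

theorem exact_iff_evaluation {J : Type*} [Category* J] (S : ShortComplex (J ⥤ ModuleCat.{u} k)) :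
    S.Exact ↔ ∀ j, (S.map ((evaluation J (ModuleCat.{u} k)).obj j)).Exact := by
  refine ⟨fun h j => h.map _, fun h => ?_⟩
  rw [S.exact_iff_isZero_homology, Functor.isZero_iff]
  intro j
  exact ((ShortComplex.exact_iff_isZero_homology _).1 (h j)).of_iso
    (S.mapHomologyIso ((evaluation J (ModuleCat.{u} k)).obj j)).symm

theorem shortExact_of_evaluation {J : Type*} [Category* J]
    (S : ShortComplex (J ⥤ ModuleCat.{u} k))
    (h : ∀ j, (S.map ((evaluation J (ModuleCat.{u} k)).obj j)).ShortExact) : S.ShortExact := by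
  have (j : J) : Mono (S.f.app j) := (h j).mono_f
  have (j : J) : Epi (S.g.app j) := (h j).epi_g
  exact
    { exact := (exact_iff_evaluation S).2 fun j => (h j).exact
      mono_f := NatTrans.mono_of_mono_app _
      epi_g := NatTrans.epi_of_epi_app _ }

/-! ### Box modules -/

/-- A sign vector `a` and a grade `z` describe a box of grades `v`: a coordinate `i` with
`a i = -1` requires `-z i < v i`, one with `a i = 1` requires `v i ≤ -z i`, and one with `a i = 0`
requires nothing. -/
def InBox (a : Fin N → SignType) (z v : Grade N) : Prop :=
  ∀ i, (a i = -1 → -z i < v i) ∧ (a i = 1 → v i ≤ -z i)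

/-- Convexity, jointly in sign vector, parameter and grade: lower bounds are inherited from the
smaller triple, upper bounds from the larger one. -/
theorem InBox.of_between {a a' a'' : Fin N → SignType} {z z' z'' v v' v'' : Grade N}
    (h : InBox a z v) (h'' : InBox a'' z'' v'') (ha : a ≤ a') (ha' : a' ≤ a'')
    (hz : z ≤ z') (hz' : z' ≤ z'') (hv : v ≤ v') (hv' : v' ≤ v'') : InBox a' z' v' := by
  intro i
  have h1 := h i
  have h2 := h'' i
  have e1 : z i ≤ z' i := hz i
  have e2 : z' i ≤ z'' i := hz' i
  have e3 : v i ≤ v' i := hv i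
  have e4 : v' i ≤ v'' i := hv' i
  have e5 := ha i
  have e6 := ha' i
  constructor
  · intro h0
    have : a i = -1 := SignType.le_neg_one_iff.1 (h0 ▸ e5)
    have := h1.1 this
    omega
  · intro h0
    have : a'' i = 1 := SignType.one_le_iff.1 (h0 ▸ e6)
    have := h2.2 this
    omega

/-- The component in grade `v` of the indicator module of the box of `a` and `z`. -/
def boxComponent (k : Type u) [Field k] (a : Fin N → SignType) (z v : Grade N) :
    Submodule k k where
  carrier := {c | ¬ InBox a z v → c = 0}
  add_mem' ha hb h := by rw [ha h, hb h, add_zero]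
  zero_mem' _ := rfl
  smul_mem' c x hx h := by rw [hx h, smul_zero]

open Classical in
/-- The map between components of indicator modules that is the identity wherever it can be. -/
noncomputable def boxMap (k : Type u) [Field k] (a a' : Fin N → SignType) (z z' v v' : Grade N) :
    boxComponent k a z v →ₗ[k] boxComponent k a' z' v' where
  toFun c := ⟨if InBox a' z' v' then c.1 else 0, fun h => if_neg h⟩
  map_add' c c' := by
    ext
    by_cases h : InBox a' z' v' <;> simp [h]
  map_smul' r c := by
    ext
    by_cases h : InBox a' z' v' <;> simp [h]

theorem boxMap_coe_of_inBox {a a' : Fin N → SignType} {z z' v v' : Grade N}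
    (h : InBox a' z' v') (c : boxComponent k a z v) : (boxMap k a a' z z' v v' c).1 = c.1 :=
  if_pos h

theorem boxComponent_eq_zero {a : Fin N → SignType} {z v : Grade N}
    (h : ¬ InBox a z v) (c : boxComponent k a z v) : c = 0 :=
  Subtype.ext (c.2 h)

theorem boxMap_coe_of_imp {a a' : Fin N → SignType} {z z' v v' : Grade N}
    (h : InBox a z v → InBox a' z' v') (c : boxComponent k a z v) :
    (boxMap k a a' z z' v v' c).1 = c.1 := by
  by_cases h0 : InBox a z v
  · exact boxMap_coe_of_inBox (h h0) c
  · rw [boxComponent_eq_zero h0 c, map_zero]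
    rfl

theorem boxMap_self (a : Fin N → SignType) (z v : Grade N) (c : boxComponent k a z v) :
    boxMap k a a z z v v c = c := by
  by_cases h : InBox a z v
  · exact Subtype.ext (boxMap_coe_of_inBox h c)
  · rw [boxComponent_eq_zero h c, map_zero]

/-- By convexity the middle component is nonzero whenever the outer two are, so nothing is lost on
the way. All functoriality and naturality of box modules comes from this. -/
theorem boxMap_boxMap {a a' a'' : Fin N → SignType} {z z' z'' v v' v'' : Grade N}
    (ha : a ≤ a') (ha' : a' ≤ a'') (hz : z ≤ z') (hz' : z' ≤ z'') (hv : v ≤ v') (hv' : v' ≤ v'')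
    (c : boxComponent k a z v) :
    boxMap k a' a'' z' z'' v' v'' (boxMap k a a' z z' v v' c) = boxMap k a a'' z z'' v v'' c := by
  by_cases h : InBox a z v
  · by_cases h'' : InBox a'' z'' v''
    · ext
      rw [boxMap_coe_of_inBox h'', boxMap_coe_of_inBox h'', boxMap_coe_of_inBox
        (h.of_between h'' ha ha' hz hz' hv hv')]
    · exact (boxComponent_eq_zero h'' _).trans (boxComponent_eq_zero h'' _).symm
  · rw [boxComponent_eq_zero h c, map_zero, map_zero, map_zero]

/-- The indicator module of the box of `a` and `z`. -/
noncomputable def boxModule (k : Type u) [Field k] (a : Fin N → SignType) (z : Grade N) :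
    Pers k N where
  obj v := ModuleCat.of k (boxComponent k a z v)
  map _ := ModuleCat.ofHom (boxMap k a a z z _ _)
  map_id v := ModuleCat.hom_ext (LinearMap.ext fun c => boxMap_self a z v c)
  map_comp f g := ModuleCat.hom_ext (LinearMap.ext fun c =>
    (boxMap_boxMap le_rfl le_rfl le_rfl le_rfl (leOfHom f) (leOfHom g) c).symm)

/-- The morphism between indicator modules that is the identity wherever it can be. -/
noncomputable def boxModuleHom (k : Type u) [Field k] {a a' : Fin N → SignType} {z z' : Grade N}
    (ha : a ≤ a') (hz : z ≤ z') : boxModule k a z ⟶ boxModule k a' z' where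
  app v := ModuleCat.ofHom (boxMap k a a' z z' v v)
  naturality _ _ f := ModuleCat.hom_ext (LinearMap.ext fun c =>
    (boxMap_boxMap le_rfl ha le_rfl hz (leOfHom f) le_rfl c).trans
      (boxMap_boxMap ha le_rfl hz le_rfl le_rfl (leOfHom f) c).symm)

theorem boxModuleHom_comp {a a' a'' : Fin N → SignType} {z z' z'' : Grade N}
    (ha : a ≤ a') (hz : z ≤ z') (ha' : a' ≤ a'') (hz' : z' ≤ z'') :
    boxModuleHom k ha hz ≫ boxModuleHom k ha' hz' =
      boxModuleHom k (ha.trans ha') (hz.trans hz') := by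
  ext v : 2
  exact ModuleCat.hom_ext (LinearMap.ext fun c => boxMap_boxMap ha ha' hz hz' le_rfl le_rfl c)

/-- The indicator modules of the boxes of `a`, as a functor of the grade `z`. -/
noncomputable def boxes (k : Type u) [Field k] (a : Fin N → SignType) : Grade N ⥤ Pers k N where
  obj := boxModule k a
  map f := boxModuleHom k le_rfl (leOfHom f)
  map_id _ := by
    ext v : 2
    exact ModuleCat.hom_ext (LinearMap.ext fun c => boxMap_self a _ v c)
  map_comp f g := (boxModuleHom_comp le_rfl (leOfHom f) le_rfl (leOfHom g)).symm

/-- Enlarging the sign vector induces a map of indicator modules. -/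
noncomputable def boxesHom (k : Type u) [Field k] {a a' : Fin N → SignType} (ha : a ≤ a') :
    boxes k a ⟶ boxes k a' where
  app _ := boxModuleHom k ha le_rfl
  naturality _ _ f := (boxModuleHom_comp le_rfl (leOfHom f) ha le_rfl).trans
    (boxModuleHom_comp ha le_rfl le_rfl (leOfHom f)).symm

theorem update_le_update {a : Fin N → SignType} (i : Fin N) {s t : SignType} (h : s ≤ t) :
    Function.update a i s ≤ Function.update a i t :=
  update_le_update_iff.2 ⟨h, fun _ _ => le_rfl⟩

theorem inBox_update {a : Fin N → SignType} (i : Fin N) (s : SignType) (z v : Grade N) :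
    InBox (Function.update a i s) z v ↔
      InBox (Function.update a i 0) z v ∧ (s = -1 → -z i < v i) ∧ (s = 1 → v i ≤ -z i) := by
  constructor
  · intro h
    refine ⟨fun j => ?_, by simpa using h i⟩
    rcases eq_or_ne j i with rfl | hj
    · simp
    · simpa [hj] using h j
  · rintro ⟨h, h'⟩ j
    rcases eq_or_ne j i with rfl | hj
    · simpa using h'
    · simpa [hj] using h j

/-! ### Exactness of the splitting of a box along one coordinate -/

section split

variable (a : Fin N → SignType) (i : Fin N) (z v : Grade N)

theorem boxMap_update_injective : Function.Injective
    (boxMap k (Function.update a i (-1)) (Function.update a i 0) z z v v) := by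
  refine (injective_iff_map_eq_zero _).2 fun c hc => ?_
  by_cases h : InBox (Function.update a i (-1)) z v
  · ext
    rw [← boxMap_coe_of_inBox ((inBox_update i _ z v).1 h).1 c, hc]
    rfl
  · exact boxComponent_eq_zero h c

theorem boxMap_update_surjective : Function.Surjective
    (boxMap k (Function.update a i 0) (Function.update a i 1) z z v v) := by
  intro c
  by_cases h : InBox (Function.update a i 1) z v
  · exact ⟨⟨c.1, fun h' => absurd ((inBox_update i _ z v).1 h).1 h'⟩,
      Subtype.ext (boxMap_coe_of_inBox h _)⟩
  · exact ⟨0, by rw [map_zero]; exact (boxComponent_eq_zero h c).symm⟩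

theorem boxMap_update_comp (c : boxComponent k (Function.update a i (-1)) z v) :
    boxMap k (Function.update a i 0) (Function.update a i 1) z z v v
      (boxMap k (Function.update a i (-1)) (Function.update a i 0) z z v v c) = 0 := by
  by_cases h : InBox (Function.update a i (-1)) z v
  · refine boxComponent_eq_zero (fun h' => ?_) _
    have h1 := (inBox_update i _ z v).1 h
    have h2 := (inBox_update i _ z v).1 h'
    exact absurd (h1.2.1 rfl) (not_lt.2 (h2.2.2 rfl))
  · rw [boxComponent_eq_zero h c, map_zero, map_zero]

/-- A grade of the large box satisfies exactly one of `-z i < v i` and `v i ≤ -z i`, so one outer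
component is all of `k` and the other is zero. -/
theorem boxMap_update_exact : Function.Exact
    (boxMap k (Function.update a i (-1)) (Function.update a i 0) z z v v)
    (boxMap k (Function.update a i 0) (Function.update a i 1) z z v v) := by
  intro c
  refine ⟨fun hc => ?_, ?_⟩
  · by_cases h : InBox (Function.update a i 0) z v
    · rcases lt_or_ge (-z i) (v i) with h' | h'
      · have h1 : InBox (Function.update a i (-1)) z v :=
          (inBox_update i _ z v).2 ⟨h, fun _ => h', fun h => absurd h (by decide)⟩
        exact ⟨⟨c.1, fun h => absurd h1 h⟩, Subtype.ext (boxMap_coe_of_inBox h _)⟩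
      · have h1 : InBox (Function.update a i 1) z v :=
          (inBox_update i _ z v).2 ⟨h, fun h => absurd h (by decide), fun _ => h'⟩
        have : c = 0 := by
          ext
          rw [← boxMap_coe_of_inBox h1 c, hc]
          rfl
        exact ⟨0, by rw [this, map_zero]⟩
    · exact ⟨0, by rw [boxComponent_eq_zero h c, map_zero]⟩
  · rintro ⟨c, rfl⟩
    exact boxMap_update_comp a i z v c

end split

/-- Splitting the box with free coordinate `i` into its upper and its lower part. -/
noncomputable def boxesShortComplex (k : Type u) [Field k] (a : Fin N → SignType) (i : Fin N) :
    ShortComplex (Grade N ⥤ Pers k N) where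
  X₁ := boxes k (Function.update a i (-1))
  X₂ := boxes k (Function.update a i 0)
  X₃ := boxes k (Function.update a i 1)
  f := boxesHom k (update_le_update i (by decide))
  g := boxesHom k (update_le_update i (by decide))
  zero := by
    ext z v : 4
    exact ModuleCat.hom_ext (LinearMap.ext fun c => boxMap_update_comp a i z v c)

theorem boxesShortComplex_shortExact (a : Fin N → SignType) (i : Fin N) (z : Grade N) :
    ((boxesShortComplex k a i).map ((evaluation _ _).obj z)).ShortExact :=
  shortExact_of_evaluation _ fun v => ModuleCat.shortComplex_shortExact _
    (boxMap_update_exact a i z v) (boxMap_update_injective a i z v)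
    (boxMap_update_surjective a i z v)

/-! ### Morphisms into a functor of persistence modules -/

/-- The contravariant functor that sends `M` to the persistence module `z ↦ Hom(M, B_z)`. -/
def homInto (B : Grade N ⥤ Pers k N) : (Pers k N)ᵒᵖ ⥤ Pers k N where
  obj M :=
    { obj := fun z => ModuleCat.of k (M.unop ⟶ B.obj z)
      map := fun f => ModuleCat.ofHom (Linear.rightComp k M.unop (B.map f))
      map_id := fun z => ModuleCat.hom_ext (LinearMap.ext fun φ => by simp)
      map_comp := fun f g => ModuleCat.hom_ext (LinearMap.ext fun φ => by simp) }
  map f :=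
    { app := fun z => ModuleCat.ofHom (Linear.leftComp k (B.obj z) f.unop)
      naturality := fun _ _ g => ModuleCat.hom_ext (LinearMap.ext fun φ =>
        (Category.assoc f.unop φ (B.map g)).symm) }
  map_id M := by
    ext z : 2
    exact ModuleCat.hom_ext (LinearMap.ext fun φ => Category.id_comp (Y := B.obj z) φ)
  map_comp f g := by
    ext z : 2
    exact ModuleCat.hom_ext (LinearMap.ext fun φ =>
      Category.assoc (Z := B.obj z) g.unop f.unop φ)

instance (B : Grade N ⥤ Pers k N) : (homInto B).Additive where
  map_add {_ _ f g} := by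
    ext z : 2
    exact ModuleCat.hom_ext (LinearMap.ext fun φ =>
      Preadditive.add_comp _ _ (B.obj z) f.unop g.unop φ)

/-- The functor `homInto B` is functorial in `B`. -/
def homIntoMap {B B' : Grade N ⥤ Pers k N} (β : B ⟶ B') : homInto B ⟶ homInto B' where
  app M :=
    { app := fun z => ModuleCat.ofHom (Linear.rightComp k M.unop (β.app z))
      naturality := fun z z' f => ModuleCat.hom_ext (LinearMap.ext fun φ =>
        (Category.assoc (show M.unop ⟶ B.obj z from φ) (B.map f) (β.app z')).trans
          ((congrArg ((show M.unop ⟶ B.obj z from φ) ≫ ·) (β.naturality f)).trans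
            (Category.assoc (show M.unop ⟶ B.obj z from φ) (β.app z) (B'.map f)).symm)) }
  naturality M M' f := by
    ext z : 2
    exact ModuleCat.hom_ext (LinearMap.ext fun φ => Category.assoc f.unop φ (β.app z))

/-- The maps that a short complex of functors induces on morphisms out of `M`. -/
def homIntoShortComplex (S : ShortComplex (Grade N ⥤ Pers k N)) (M : Pers k N) :
    ShortComplex (Pers k N) where
  X₁ := (homInto S.X₁).obj (.op M)
  X₂ := (homInto S.X₂).obj (.op M)
  X₃ := (homInto S.X₃).obj (.op M)
  f := (homIntoMap S.f).app (.op M)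
  g := (homIntoMap S.g).app (.op M)
  zero := by
    ext z : 2
    refine ModuleCat.hom_ext (LinearMap.ext fun φ => ?_)
    change ((show M ⟶ S.X₁.obj z from φ) ≫ S.f.app z) ≫ S.g.app z = 0
    rw [Category.assoc, ← NatTrans.comp_app, S.zero]
    exact comp_zero

/-- Left exactness of Hom; projectivity of `M` serves only for surjectivity on the right. -/
theorem homIntoShortComplex_shortExact {S : ShortComplex (Grade N ⥤ Pers k N)}
    (hS : ∀ z, (S.map ((evaluation _ _).obj z)).ShortExact) (M : Pers k N) [Projective M] :
    (homIntoShortComplex S M).ShortExact := by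
  refine shortExact_of_evaluation _ fun z => ModuleCat.shortComplex_shortExact _ ?_ ?_ ?_
  · intro (φ : M ⟶ S.X₂.obj z)
    have := (hS z).mono_f
    refine ⟨fun (h : φ ≫ S.g.app z = 0) => ⟨(hS z).exact.lift φ h, (hS z).exact.lift_f φ h⟩, ?_⟩
    rintro ⟨ψ, rfl⟩
    exact LinearMap.congr_fun (congrArg (fun t => (t.app z).hom) (homIntoShortComplex S M).zero) ψ
  · intro (φ : M ⟶ S.X₁.obj z) (ψ : M ⟶ S.X₁.obj z) (h : φ ≫ S.f.app z = ψ ≫ S.f.app z)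
    have : Mono (S.f.app z) := (hS z).mono_f
    exact (cancel_mono (S.f.app z)).1 h
  · intro (φ : M ⟶ S.X₃.obj z)
    have : Epi (S.g.app z) := (hS z).epi_g
    exact ⟨Projective.factorThru φ (S.g.app z), Projective.factorThru_comp φ (S.g.app z)⟩

/-! ### Functoriality of the dual complex -/

/-- The cochain complex `G(C)` is functorial in `G`. -/
def dualComplexMap {G G' : (Pers k N)ᵒᵖ ⥤ Pers k N} [G.Additive] [G'.Additive] (τ : G ⟶ G') :
    dualComplex G ⟶ dualComplex G' where
  app C :=
    { f := fun i => τ.app (.op (C.unop.X i))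
      comm' := fun i j _ => (τ.naturality (C.unop.d j i).op).symm }
  naturality C C' f := by
    ext1 i
    exact τ.naturality (f.unop.f i).op

/-- Isomorphic functors have isomorphic dual complexes. -/
def dualComplexIso {G G' : (Pers k N)ᵒᵖ ⥤ Pers k N} [G.Additive] [G'.Additive] (e : G ≅ G') :
    dualComplex G ≅ dualComplex G' where
  hom := dualComplexMap e.hom
  inv := dualComplexMap e.inv
  hom_inv_id := by
    ext C i : 3
    exact e.hom_inv_id_app _
  inv_hom_id := by
    ext C i : 3
    exact e.inv_hom_id_app _

/-- The short complex of cochain complexes of morphisms out of a chain complex `C`. -/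
def dualShortComplex (S : ShortComplex (Grade N ⥤ Pers k N))
    (C : (ChainComplex (Pers k N) ℤ)ᵒᵖ) : ShortComplex (CochainComplex (Pers k N) ℤ) where
  X₁ := (dualComplex (homInto S.X₁)).obj C
  X₂ := (dualComplex (homInto S.X₂)).obj C
  X₃ := (dualComplex (homInto S.X₃)).obj C
  f := (dualComplexMap (homIntoMap S.f)).app C
  g := (dualComplexMap (homIntoMap S.g)).app C
  zero := by
    ext1 i
    exact (homIntoShortComplex S (C.unop.X i)).zero

/-- A chain map induces a morphism of the short complexes of cochain complexes. -/
def dualShortComplexMap (S : ShortComplex (Grade N ⥤ Pers k N))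
    {C C' : (ChainComplex (Pers k N) ℤ)ᵒᵖ} (f : C ⟶ C') :
    dualShortComplex S C ⟶ dualShortComplex S C' where
  τ₁ := (dualComplex (homInto S.X₁)).map f
  τ₂ := (dualComplex (homInto S.X₂)).map f
  τ₃ := (dualComplex (homInto S.X₃)).map f
  comm₁₂ := (dualComplexMap (homIntoMap S.f)).naturality f
  comm₂₃ := (dualComplexMap (homIntoMap S.g)).naturality f

theorem dualShortComplex_shortExact {S : ShortComplex (Grade N ⥤ Pers k N)}
    (hS : ∀ z, (S.map ((evaluation _ _).obj z)).ShortExact) (C : ChainComplex (Pers k N) ℤ)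
    (hC : ∀ i, Projective (C.X i)) : (dualShortComplex S (.op C)).ShortExact :=
  HomologicalComplex.shortExact_of_degreewise_shortExact _ fun i =>
    have := hC i
    homIntoShortComplex_shortExact hS (C.X i)

/-- The cohomology in degree `j` of the complex of morphisms out of `C` into `B`. -/
noncomputable abbrev extFunctor (B : Grade N ⥤ Pers k N) (j : ℤ) :
    (ChainComplex (Pers k N) ℤ)ᵒᵖ ⥤ Pers k N :=
  dualComplex (homInto B) ⋙ HomologicalComplex.homologyFunctor (Pers k N) (ComplexShape.up ℤ) j

/-- The connecting map sits between two cohomology modules of the middle term, both zero; its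
naturality in `C` makes the isomorphism one of functors. -/
theorem nonempty_extFunctor_iso {S : ShortComplex (Grade N ⥤ Pers k N)}
    (hS : ∀ z, (S.map ((evaluation _ _).obj z)).ShortExact)
    (P : ObjectProperty (ChainComplex (Pers k N) ℤ)) (hP : ∀ C, P C → ∀ i, Projective (C.X i))
    {j j' : ℤ} (hj : j + 1 = j')
    (h : ∀ C, P C → IsZero ((extFunctor S.X₂ j).obj (.op C)))
    (h' : ∀ C, P C → IsZero ((extFunctor S.X₂ j').obj (.op C))) :
    Nonempty (P.ι.op ⋙ extFunctor S.X₃ j ≅ P.ι.op ⋙ extFunctor S.X₁ j') :=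
  ⟨NatIso.ofComponents
    (fun C => (dualShortComplex_shortExact hS C.unop.obj (hP _ C.unop.property)).δIso j j' hj
      (h _ C.unop.property) (h' _ C.unop.property))
    fun {C C'} f => (HomologicalComplex.HomologySequence.δ_naturality
      (dualShortComplexMap S (P.ι.op.map f))
      (dualShortComplex_shortExact hS C.unop.obj (hP _ C.unop.property))
      (dualShortComplex_shortExact hS C'.unop.obj (hP _ C'.unop.property)) j j' hj).symm⟩

theorem isZero_extFunctor {S : ShortComplex (Grade N ⥤ Pers k N)}
    (hS : ∀ z, (S.map ((evaluation _ _).obj z)).ShortExact)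
    {C : ChainComplex (Pers k N) ℤ} (hC : ∀ i, Projective (C.X i))
    {j j' : ℤ} (hj : j + 1 = j') (h₃ : IsZero ((extFunctor S.X₃ j).obj (.op C)))
    (h₂ : IsZero ((extFunctor S.X₂ j').obj (.op C))) :
    IsZero ((extFunctor S.X₁ j').obj (.op C)) :=
  ((dualShortComplex_shortExact hS C hC).homology_exact₁ j j' hj).isZero_of_both_zeros
    (h₃.eq_of_src _ _) (h₂.eq_of_tgt _ _)

/-! ### The pointwise dual is exact -/

instance : (pointwiseDual k N).Additive where
  map_add {L M f g} := by
    ext z : 2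
    exact ModuleCat.hom_ext (LinearMap.ext fun φ => LinearMap.ext fun x =>
      map_add (show Module.Dual k (L.unop.obj (-z)) from φ)
        ((f.unop.app (-z)).hom x) ((g.unop.app (-z)).hom x))

/-- Over a field, kernels and ranges of transposes are the annihilators of ranges and kernels, so
dualizing is exact. -/
instance : (pointwiseDual k N).PreservesHomology := by
  refine Functor.preservesHomology_of_map_exact _ fun S hS => ?_
  refine (exact_iff_evaluation _).2 fun z => ModuleCat.shortComplex_exact _ ?_
  have h := (exact_iff_evaluation _).1 hS.unop (-z)
  have h' : LinearMap.range (S.g.unop.app (-z)).hom = LinearMap.ker (S.f.unop.app (-z)).hom :=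
    h.moduleCat_range_eq_ker
  refine LinearMap.exact_iff.2 ?_
  change LinearMap.ker (S.g.unop.app (-z)).hom.dualMap =
    LinearMap.range (S.f.unop.app (-z)).hom.dualMap
  rw [LinearMap.ker_dualMap_eq_dualAnnihilator_range, h',
    LinearMap.range_dualMap_eq_dualAnnihilator_ker]

/-- A contravariant additive functor that preserves homology exchanges homology and cohomology. -/
noncomputable def dualComplexHomologyIso (G : (Pers k N)ᵒᵖ ⥤ Pers k N) [G.Additive]
    [G.PreservesHomology] (j : ℤ) :
    dualComplex G ⋙ HomologicalComplex.homologyFunctor (Pers k N) (ComplexShape.up ℤ) j ≅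
      (HomologicalComplex.homologyFunctor (Pers k N) (ComplexShape.down ℤ) j).op ⋙ G :=
  Functor.isoWhiskerLeft (dualComplex G)
      (HomologicalComplex.homologyFunctorIso (Pers k N) (ComplexShape.up ℤ) j) ≪≫
    Functor.isoWhiskerRight (show dualComplex G ⋙
        HomologicalComplex.shortComplexFunctor (Pers k N) (ComplexShape.up ℤ) j ≅
        (HomologicalComplex.shortComplexFunctor (Pers k N) (ComplexShape.down ℤ) j).op ⋙
          ShortComplex.opFunctor (Pers k N) ⋙ G.mapShortComplex from
        NatIso.ofComponents (fun C => Iso.refl _)) (ShortComplex.homologyFunctor _) ≪≫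
    Functor.isoWhiskerLeft ((HomologicalComplex.shortComplexFunctor (Pers k N)
        (ComplexShape.down ℤ) j).op ⋙ ShortComplex.opFunctor (Pers k N))
      (ShortComplex.homologyFunctorIso G) ≪≫
    Functor.isoWhiskerRight (Functor.isoWhiskerLeft (HomologicalComplex.shortComplexFunctor
        (Pers k N) (ComplexShape.down ℤ) j).op
          (ShortComplex.homologyFunctorOpNatIso (Pers k N)).symm) G ≪≫
    Functor.isoWhiskerRight (NatIso.op (HomologicalComplex.homologyFunctorIso (Pers k N)
      (ComplexShape.down ℤ) j)) G

/-! ### The dualities as functors of morphisms into box modules -/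

theorem inBox_one {z v : Grade N} : InBox (fun _ => 1) z v ↔ v ≤ -z :=
  ⟨fun h i => (h i).2 rfl, fun h i => ⟨fun h => absurd (show (1 : SignType) = -1 from h) (by decide),
    fun _ => h i⟩⟩

/-- Over the integers the strict bound `-z i < v i` is `1 ≤ z i + v i`; this is why the global dual
uses `F(1,…,1)`. -/
theorem inBox_neg_one {z v : Grade N} : InBox (fun _ => -1) z v ↔ 1 ≤ z + v := by
  refine ⟨fun h i => ?_, fun h i => ⟨fun _ => ?_,
    fun h => absurd (show (-1 : SignType) = 1 from h) (by decide)⟩⟩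
  · have : -z i < v i := (h i).1 rfl
    change 1 ≤ z i + v i
    omega
  · have : 1 ≤ z i + v i := h i
    omega

/-- The morphism from `M` into the indicator module of `{v | v ≤ -z}` that belongs to a linear form
on the component `M_{-z}`. -/
noncomputable def ofDual (M : Pers k N) (z : Grade N) (φ : Module.Dual k (M.obj (-z))) :
    M ⟶ boxModule k (fun _ => 1) z := by
  classical exact
  { app := fun v => ModuleCat.ofHom
      { toFun := fun m => ⟨if h : v ≤ -z then φ ((M.map (homOfLE h)).hom m) else 0,
          fun h => dif_neg fun h' => h (inBox_one.2 h')⟩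
        map_add' := fun m m' => by
          ext
          by_cases h : v ≤ -z <;> simp [h]
        map_smul' := fun c m => by
          ext
          by_cases h : v ≤ -z <;> simp [h] }
    naturality := fun v v' f => by
      refine ModuleCat.hom_ext (LinearMap.ext fun m => ?_)
      by_cases h : v' ≤ -z
      · have h0 : v ≤ -z := (leOfHom f).trans h
        refine Subtype.ext (Eq.trans ?_ (boxMap_coe_of_inBox (inBox_one.2 h) _).symm)
        refine (dif_pos h).trans (Eq.trans ?_ (dif_pos h0).symm)
        exact congrArg (fun t => φ (t.hom m)) (M.map_comp f (homOfLE h)).symm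
      · exact (boxComponent_eq_zero (mt inBox_one.1 h) _).trans
          (boxComponent_eq_zero (mt inBox_one.1 h) _).symm }

/-- Morphisms from `M` into the indicator module of `{v | v ≤ -z}` are the linear forms on
`M_{-z}`. -/
noncomputable def homBoxEquiv (M : Pers k N) (z : Grade N) :
    (M ⟶ boxModule k (fun _ => 1) z) ≃ₗ[k] Module.Dual k (M.obj (-z)) where
  toFun f := (boxComponent k (fun _ => 1) z (-z)).subtype ∘ₗ (f.app (-z)).hom
  map_add' _ _ := rfl
  map_smul' _ _ := rfl
  invFun := ofDual M z
  left_inv f := by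
    ext v : 2
    refine ModuleCat.hom_ext (LinearMap.ext fun m => ?_)
    by_cases h : v ≤ -z
    · refine Subtype.ext ((dif_pos h).trans ?_)
      -- The structure map of the box module from `v` to its top grade `-z` is the identity of `k`,
      -- so `f` is determined by its component there.
      have := congrArg (fun t => (t.hom m)) (f.naturality (homOfLE h))
      refine (congrArg Subtype.val this).trans ?_
      exact boxMap_coe_of_inBox (inBox_one.2 le_rfl) _
    · exact (boxComponent_eq_zero (mt inBox_one.1 h) _).trans
          (boxComponent_eq_zero (mt inBox_one.1 h) _).symm
  right_inv φ := by
    refine LinearMap.ext fun m => (dif_pos le_rfl).trans ?_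
    exact congrArg (fun t => φ (t.hom m)) (M.map_id (-z))

/-- The pointwise dual is represented by the indicator modules of the sets `{v | v ≤ -z}`. -/
noncomputable def homIntoBoxesOneIso (k : Type u) [Field k] (N : ℕ) :
    homInto (boxes k (N := N) fun _ => 1) ≅ pointwiseDual k N :=
  NatIso.ofComponents
    (fun M => NatIso.ofComponents (fun z => (homBoxEquiv M.unop z).toModuleIso)
      fun {z z'} g => ModuleCat.hom_ext (LinearMap.ext fun f => LinearMap.ext fun m => by
        change M.unop ⟶ boxModule k (fun _ => 1) z at f
        refine (boxMap_coe_of_inBox (inBox_one.2 le_rfl) _).trans ?_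
        have := congrArg (fun t => (t.hom m))
          (f.naturality (homOfLE (neg_le_neg (leOfHom g)) : -z' ⟶ -z))
        refine Eq.trans ?_ (congrArg Subtype.val this).symm
        exact (boxMap_coe_of_inBox (inBox_one.2 le_rfl) _).symm))
    fun f => by
      ext z : 2
      rfl

/-- The module `F(1, …, 1)⟨z⟩` is the indicator module of the set of all grades that exceed `-z` in
all coordinates. -/
noncomputable def boxModuleNegOneIso (k : Type u) [Field k] (z : Grade N) :
    boxModule k (fun _ => -1) z ≅ shift z (free k 1) :=
  NatIso.ofComponents
    (fun v => (LinearEquiv.ofEq (boxComponent k (fun _ => -1) z v) (freeComponent k 1 (z + v))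
      (Submodule.ext fun c => by
        change (¬ InBox _ z v → c = 0) ↔ (¬ 1 ≤ z + v → c = 0)
        rw [inBox_neg_one])).toModuleIso)
    fun f => ModuleCat.hom_ext (LinearMap.ext fun c => Subtype.ext (boxMap_coe_of_imp
      (fun h => inBox_neg_one.2 ((inBox_neg_one.1 h).trans (add_le_add_right (leOfHom f) z))) c))

theorem boxModuleNegOneIso_naturality {z z' : Grade N} (h : z ≤ z') :
    boxModuleHom k le_rfl h ≫ (boxModuleNegOneIso k z').hom =
      (boxModuleNegOneIso k z).hom ≫ shiftMap (free k 1) h := by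
  ext v : 2
  exact ModuleCat.hom_ext (LinearMap.ext fun c => Subtype.ext (boxMap_coe_of_imp
    (fun h' => inBox_neg_one.2 ((inBox_neg_one.1 h').trans (add_le_add_left h v))) c))

/-- The global dual is represented by the indicator modules of the sets of all grades that exceed
`-z` in all coordinates. -/
noncomputable def homIntoBoxesNegOneIso (k : Type u) [Field k] (N : ℕ) :
    homInto (boxes k (N := N) fun _ => -1) ≅ globalDual k N :=
  NatIso.ofComponents
    (fun M => NatIso.ofComponents
      (fun z => (Linear.homCongr k (Iso.refl M.unop) (boxModuleNegOneIso k z)).toModuleIso)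
      fun {z z'} g => ModuleCat.hom_ext (LinearMap.ext fun f => by
        change M.unop ⟶ boxModule k (fun _ => -1) z at f
        change (Iso.refl M.unop).inv ≫ (f ≫ boxModuleHom k le_rfl (leOfHom g)) ≫
          (boxModuleNegOneIso k z').hom = ((Iso.refl M.unop).inv ≫ f ≫
            (boxModuleNegOneIso k z).hom) ≫ shiftMap (free k 1) (leOfHom g)
        rw [Category.assoc, boxModuleNegOneIso_naturality, Category.assoc, Category.assoc]))
    fun {M M'} f => by
      ext z : 2
      refine ModuleCat.hom_ext (LinearMap.ext fun φ => ?_)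
      change M.unop ⟶ boxModule k (fun _ => -1) z at φ
      change (Iso.refl M'.unop).inv ≫ (f.unop ≫ φ) ≫ (boxModuleNegOneIso k z).hom =
        f.unop ≫ (Iso.refl M.unop).inv ≫ φ ≫ (boxModuleNegOneIso k z).hom
      simp only [Iso.refl_inv, Category.assoc, Category.id_comp]

/-! ### Free modules are projective -/

/-- The generator of `F(z)`. -/
def freeGen (k : Type u) [Field k] (z : Grade N) : (free k z).obj z :=
  (⟨1, fun h => absurd le_rfl h⟩ : freeComponent k z z)

theorem free_eq_smul_map_freeGen {z v : Grade N} (h : z ≤ v) (c : freeComponent k z v) :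
    c = c.1 • ((free k z).map (homOfLE h)).hom (freeGen k z) :=
  Subtype.ext (mul_one c.1).symm

theorem freeComponent_eq_zero {z v : Grade N} (h : ¬ z ≤ v) (c : freeComponent k z v) : c = 0 :=
  Subtype.ext (c.2 h)

theorem free_hom_ext {z : Grade N} {M : Pers k N} {f g : free k z ⟶ M}
    (h : (f.app z).hom (freeGen k z) = (g.app z).hom (freeGen k z)) : f = g := by
  have key (f : free k z ⟶ M) {v : Grade N} (hv : z ≤ v) (c : freeComponent k z v) :
      (f.app v).hom c = c.1 • (M.map (homOfLE hv)).hom ((f.app z).hom (freeGen k z)) := by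
    refine (congrArg (f.app v).hom (free_eq_smul_map_freeGen hv c)).trans ?_
    refine ((f.app v).hom.map_smul c.1 _).trans ?_
    exact congrArg (fun t => c.1 • t.hom (freeGen k z)) (f.naturality (homOfLE hv))
  ext v : 2
  refine ModuleCat.hom_ext (LinearMap.ext fun c => ?_)
  change freeComponent k z v at c
  by_cases hv : z ≤ v
  · exact (key f hv c).trans ((congrArg (fun x => c.1 • (M.map (homOfLE hv)).hom x) h).trans
      (key g hv c).symm)
  · rw [freeComponent_eq_zero hv c]
    exact (f.app v).hom.map_zero.trans (g.app v).hom.map_zero.symm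

/-- The morphism out of `F(z)` that sends the generator to a given element. -/
noncomputable def ofElement {z : Grade N} {M : Pers k N} (x : M.obj z) : free k z ⟶ M := by
  classical exact
  { app := fun v => ModuleCat.ofHom
      (if h : z ≤ v then
        (LinearMap.toSpanSingleton k _ ((M.map (homOfLE h)).hom x)) ∘ₗ
          (freeComponent k z v).subtype
      else 0)
    naturality := fun v v' f => by
      refine ModuleCat.hom_ext (LinearMap.ext fun c => ?_)
      change freeComponent k z v at c
      by_cases h : z ≤ v
      · have h' := h.trans (leOfHom f)
        simp only [dif_pos h, dif_pos h']
        change c.1 • (M.map (homOfLE h')).hom x = (M.map f).hom (c.1 • (M.map (homOfLE h)).hom x)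
        refine Eq.trans ?_ ((M.map f).hom.map_smul c.1 _).symm
        exact congrArg (fun t => c.1 • t.hom x) (M.map_comp (homOfLE h) f)
      · rw [freeComponent_eq_zero h c]
        exact (LinearMap.map_zero _).trans (LinearMap.map_zero _).symm }

theorem ofElement_freeGen {z : Grade N} {M : Pers k N} (x : M.obj z) :
    ((ofElement x).app z).hom (freeGen k z) = x := by
  have : ((ofElement x).app z).hom = (LinearMap.toSpanSingleton k _
      ((M.map (homOfLE le_rfl)).hom x)) ∘ₗ (freeComponent k z z).subtype := dif_pos le_rfl
  rw [this]
  refine (one_smul k ((M.map (homOfLE le_rfl)).hom x)).trans ?_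
  exact congrArg (fun t => t.hom x) (M.map_id z)

instance (z : Grade N) : Projective (free k z) where
  factors {E X} f e _ := by
    obtain ⟨x, hx⟩ := (ModuleCat.epi_iff_surjective (e.app z)).1 inferInstance
      ((f.app z).hom (freeGen k z))
    refine ⟨ofElement x, free_hom_ext ?_⟩
    exact (congrArg (e.app z).hom (ofElement_freeGen x)).trans hx

theorem IsFreeOfFiniteRank.projective {M : Pers k N} (hM : IsFreeOfFiniteRank M) :
    Projective M := by
  obtain ⟨n, z, ⟨e⟩⟩ := hM
  refine Projective.of_iso e ⟨fun f q _ =>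
    ⟨Sigma.desc fun i => Projective.factorThru (Sigma.ι (fun i => free k (z i)) i ≫ f) q, ?_⟩⟩
  refine Sigma.hom_ext _ _ fun i => ?_
  rw [← Category.assoc, Sigma.ι_desc, Projective.factorThru_comp]

/-- Morphisms out of `M` are determined on finitely many generators, whose grades have a common
upper bound. A map that is injective up to that bound is thus as good as a monomorphism for testing
them. -/
theorem IsFreeOfFiniteRank.exists_bound {M : Pers k N} (hM : IsFreeOfFiniteRank M) :
    ∃ t : Grade N, ∀ (t' : Grade N), t ≤ t' → ∀ {I J : Pers k N} (q : I ⟶ J),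
      (∀ v ≤ t', Function.Injective (q.app v).hom) → ∀ f g : M ⟶ I, f ≫ q = g ≫ q → f = g := by
  obtain ⟨n, z, ⟨e⟩⟩ := hM
  obtain ⟨t, ht⟩ : BddAbove (Set.range (α := Fin N → ℤ) z) := (Set.finite_range _).bddAbove
  refine ⟨t, fun t' htt' I J q hq f g h => ?_⟩
  rw [← cancel_epi e.hom]
  refine Sigma.hom_ext _ _ fun l => free_hom_ext ?_
  have hl : z l ≤ t' := le_trans (ht ⟨l, rfl⟩) htt'
  refine hq (z l) hl ?_
  exact congrArg (fun s => ((Sigma.ι (fun i => free k (z i)) l ≫ e.hom ≫ s).app (z l)).hom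
    (freeGen k (z l))) h

/-! ### Vanishing of cohomology -/

/-- Evaluation at `z` commutes with homology, which reduces vanishing to "every cocycle is a
coboundary". -/
theorem isZero_extFunctor_obj_obj_iff (B : Grade N ⥤ Pers k N) (C : ChainComplex (Pers k N) ℤ)
    (j : ℤ) (z : Grade N) :
    IsZero (((extFunctor B j).obj (.op C)).obj z) ↔
      ∀ φ : C.X j ⟶ B.obj z, C.d (j + 1) j ≫ φ = 0 →
        ∃ ψ : C.X (j - 1) ⟶ B.obj z, C.d j (j - 1) ≫ ψ = φ := by
  let K := (dualComplex (homInto B)).obj (.op C)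
  let S := K.sc' (j - 1) j (j + 1)
  let e : K.homology j ≅ S.homology :=
    ShortComplex.homologyMapIso (K.isoSc' (j - 1) j (j + 1) (by simp) (by simp))
  have h1 : IsZero ((K.homology j).obj z) ↔
      (S.map ((evaluation (Grade N) (ModuleCat.{u} k)).obj z)).Exact := by
    rw [ShortComplex.exact_iff_isZero_homology]
    exact (e.app z ≪≫
      (S.mapHomologyIso ((evaluation (Grade N) (ModuleCat.{u} k)).obj z)).symm).isZero_iff
  exact h1.trans (ShortComplex.moduleCat_exact_iff _)

theorem isZero_extFunctor_one_obj {C : ChainComplex (Pers k N) ℤ} {j : ℤ} {z : Grade N}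
    (h : ¬ Nontrivial ((C.homology j).obj (-z))) :
    IsZero (((extFunctor (boxes k fun _ => 1) j).obj (.op C)).obj z) := by
  have := not_nontrivial_iff_subsingleton.1 h
  refine IsZero.of_iso (Y := ModuleCat.of k (Module.Dual k ((C.homology j).obj (-z)))) ?_
    (((Functor.isoWhiskerRight (dualComplexIso (homIntoBoxesOneIso k N)) _ ≪≫
      dualComplexHomologyIso (pointwiseDual k N) j).app (.op C)).app z)
  have : Subsingleton (Module.Dual k ((C.homology j).obj (-z))) :=
    ⟨fun f g => LinearMap.ext fun x => by rw [Subsingleton.elim x 0, map_zero, map_zero]⟩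
  exact ModuleCat.isZero_of_subsingleton _

/-- The quotient map from the indicator module of a box to that of a smaller lower set. -/
noncomputable def boxQuotient (k : Type u) [Field k] {a : Fin N → SignType} {z z' : Grade N}
    (h : ∀ v, v ≤ -z' → InBox a z v) : boxModule k a z ⟶ boxModule k (fun _ => 1) z' where
  app v := ModuleCat.ofHom (boxMap k a (fun _ => 1) z z' v v)
  naturality v v' f := by
    refine ModuleCat.hom_ext (LinearMap.ext fun (c : boxComponent k a z v) => ?_)
    change boxMap k a (fun _ => 1) z z' v' v' (boxMap k a a z z v v' c) =
      boxMap k (fun _ => 1) (fun _ => 1) z' z' v v' (boxMap k a (fun _ => 1) z z' v v c)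
    by_cases hv' : v' ≤ -z'
    · ext
      rw [boxMap_coe_of_inBox (inBox_one.2 hv'), boxMap_coe_of_inBox (inBox_one.2 hv'),
        boxMap_coe_of_inBox (h _ hv'),
        boxMap_coe_of_inBox (inBox_one.2 ((leOfHom f).trans hv'))]
    · exact (boxComponent_eq_zero (mt inBox_one.1 hv') _).trans
        (boxComponent_eq_zero (mt inBox_one.1 hv') _).symm

theorem boxQuotient_epi {a : Fin N → SignType} {z z' : Grade N} (h : ∀ v, v ≤ -z' → InBox a z v) :
    Epi (boxQuotient k h) := by
  have (v : Grade N) : Epi ((boxQuotient k h).app v) := by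
    refine (ModuleCat.epi_iff_surjective _).2 fun (c : boxComponent k (fun _ => 1) z' v) => ?_
    by_cases hv : v ≤ -z'
    · exact ⟨(⟨c.1, fun h' => absurd (h v hv) h'⟩ : boxComponent k a z v),
        Subtype.ext (boxMap_coe_of_inBox (inBox_one.2 hv) _)⟩
    · exact ⟨0, (map_zero _).trans (boxComponent_eq_zero (mt inBox_one.1 hv) c).symm⟩
  exact NatTrans.epi_of_epi_app _

theorem boxQuotient_injective {a : Fin N → SignType} {z z' : Grade N}
    (h : ∀ v, v ≤ -z' → InBox a z v) {v : Grade N} (hv : InBox a z v → v ≤ -z') :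
    Function.Injective ((boxQuotient k h).app v).hom := by
  intro (c : boxComponent k a z v) (c' : boxComponent k a z v) hc
  refine Subtype.ext ?_
  rw [← boxMap_coe_of_imp (fun h => inBox_one.2 (hv h)) c,
    ← boxMap_coe_of_imp (fun h => inBox_one.2 (hv h)) c']
  exact congrArg Subtype.val hc

/-- A cocycle becomes a coboundary after truncating the box to a principal lower set. The primitive
lifts by projectivity, and the truncation is invisible to the generators of `C.X j`. -/
theorem isZero_extFunctor_of_ne_neg_one {C : ChainComplex (Pers k N) ℤ} {j : ℤ}
    (hC : ∀ i, IsFreeOfFiniteRank (C.X i)) (hj : EventuallyVanishes (C.homology j))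
    {a : Fin N → SignType} (ha : ∀ i, a i ≠ -1) {i₀ : Fin N} (hi₀ : a i₀ = 0) :
    IsZero ((extFunctor (boxes k a) j).obj (.op C)) := by
  refine (Functor.isZero_iff _).2 fun z => (isZero_extFunctor_obj_obj_iff _ C j z).2 fun φ hφ => ?_
  change C.X j ⟶ boxModule k a z at φ
  obtain ⟨t₁, ht₁⟩ := (hC j).exists_bound
  obtain ⟨t₂, ht₂⟩ := hj
  -- `t` dominates the generators of `C.X j` and strictly exceeds the support bound of the homology
  -- in every coordinate.
  let t : Grade N := fun i => max (t₁ i) (t₂ i + 1)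
  -- The top grade `-z'` keeps the existing upper bounds and cuts the unrestricted coordinates off
  -- at `t`.
  let z' : Grade N := fun i => if a i = 1 then z i else - t i
  have h : ∀ v, v ≤ -z' → InBox a z v := fun v hv i => by
    refine ⟨fun h => absurd h (ha i), fun h => ?_⟩
    have h1 : v i ≤ - (if a i = 1 then z i else - t i) := hv i
    rwa [if_pos h] at h1
  have hinj : ∀ v ≤ t, Function.Injective ((boxQuotient k h).app v).hom := fun v hv =>
    boxQuotient_injective h fun hv' i => by
      change v i ≤ - (if a i = 1 then z i else - t i)
      split_ifs with hi
      · exact (hv' i).2 hi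
      · rw [neg_neg]
        exact hv i
  -- Coordinate `i₀` of `-z'` is `t i₀ > t₂ i₀`, so this grade lies outside the support; one
  -- unrestricted coordinate is enough.
  have hz : ¬ Nontrivial ((C.homology j).obj (-z')) := fun hn => by
    have h1 : - (if a i₀ = 1 then z i₀ else - t i₀) ≤ t₂ i₀ := ht₂ hn i₀
    rw [hi₀, if_neg (by decide), neg_neg] at h1
    have h2 : t₂ i₀ + 1 ≤ t i₀ := le_max_right _ _
    omega
  obtain ⟨ψ, hψ⟩ := (isZero_extFunctor_obj_obj_iff _ C j z').1 (isZero_extFunctor_one_obj hz)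
    (φ ≫ boxQuotient k h) ((Category.assoc _ φ (boxQuotient k h)).symm.trans
      ((congrArg (· ≫ boxQuotient k h) hφ).trans zero_comp))
  change C.X (j - 1) ⟶ boxModule k (fun _ => 1) z' at ψ
  obtain ⟨χ, hχ⟩ := @Projective.factors _ _ _ (hC (j - 1)).projective _ _ ψ (boxQuotient k h)
    (boxQuotient_epi h)
  refine ⟨χ, ?_⟩
  refine ht₁ t (fun i => le_max_left _ _) (boxQuotient k h) hinj _ _ ?_
  exact (Category.assoc _ _ _).trans ((congrArg (C.d j (j - 1) ≫ ·) hχ).trans hψ)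

/-- Replacing an entry `-1` by `1` or by `0` lowers `p`. The long exact sequence encloses the group
in degree `j` between those for `1` in degree `j - 1` and for `0` in degree `j`; the shift by one
explains the lower limit `d + p`. -/
theorem isZero_extFunctor_of_isAdmissible {d : ℤ} {C : ChainComplex (Pers k N) ℤ}
    (hC : IsAdmissible k N d C) (p : ℕ) {a : Fin N → SignType}
    (hp : (Finset.univ.filter fun i => a i = -1).card = p) {i₀ : Fin N} (hi₀ : a i₀ = 0) {j : ℤ}
    (hj : d + p ≤ j) (hj' : j ≤ d + N) : IsZero ((extFunctor (boxes k a) j).obj (.op C)) := by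
  induction p generalizing a j with
  | zero =>
    refine isZero_extFunctor_of_ne_neg_one hC.1 (hC.2 j (by simpa using hj) hj') (fun i hi => ?_) hi₀
    rw [Finset.card_eq_zero] at hp
    exact Finset.notMem_empty i (hp ▸ Finset.mem_filter.2 ⟨Finset.mem_univ i, hi⟩)
  | succ p ih =>
    push_cast at hj
    obtain ⟨i, hi⟩ := Finset.card_pos.1 (p.succ_pos.trans_eq hp.symm)
    have hi' : a i = -1 := (Finset.mem_filter.1 hi).2
    -- The unrestricted coordinate `i₀` must survive the replacement for the induction hypothesis to
    -- apply.
    have hne : i₀ ≠ i := by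
      rintro rfl
      exact absurd (hi₀.symm.trans hi') (by decide)
    have hcard (s : SignType) (hs : s ≠ -1) :
        (Finset.univ.filter fun l => Function.update a i s l = -1).card = p := by
      have : (Finset.univ.filter fun l => Function.update a i s l = -1) =
          (Finset.univ.filter fun l => a l = -1).erase i := by
        ext l
        rcases eq_or_ne l i with rfl | hl
        · simp [hs]
        · simp [hl]
      rw [this, Finset.card_erase_of_mem hi, hp, Nat.add_sub_cancel]
    have key := isZero_extFunctor (boxesShortComplex_shortExact (k := k) a i)
      (fun l => (hC.1 l).projective) (sub_add_cancel j 1)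
      (ih (hcard 1 (by decide)) (by simpa [hne] using hi₀) (by omega) (by omega))
      (ih (hcard 0 (by decide)) (by simpa [hne] using hi₀) (by omega) (by omega))
    have e : Function.update a i (-1) = a := by rw [← hi', Function.update_eq_self]
    change IsZero ((extFunctor (boxes k (Function.update a i (-1))) j).obj (.op C)) at key
    rwa [e] at key

/-! ### The duality -/

/-- The sign vector with entries `-1` in the first `m` coordinates and `1` in the others. -/
def signStep (N m : ℕ) : Fin N → SignType := fun i => if i.val < m then -1 else 1

theorem update_signStep_one {m : ℕ} (hm : m < N) :
    Function.update (signStep N m) ⟨m, hm⟩ 1 = signStep N m := by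
  rw [Function.update_eq_iff]
  exact ⟨by simp [signStep], fun _ _ => rfl⟩

theorem update_signStep_neg_one {m : ℕ} (hm : m < N) :
    Function.update (signStep N m) ⟨m, hm⟩ (-1) = signStep N (m + 1) := by
  rw [Function.update_eq_iff]
  refine ⟨by simp [signStep], fun i hi => ?_⟩
  have : i.val ≠ m := fun h => hi (Fin.ext h)
  simp only [signStep]
  congr 1
  exact propext (by omega)

theorem card_update_signStep_zero {m : ℕ} (hm : m < N) :
    (Finset.univ.filter fun i => Function.update (signStep N m) ⟨m, hm⟩ 0 i = -1).card = m := by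
  have : (Finset.univ.filter fun i => Function.update (signStep N m) ⟨m, hm⟩ 0 i = -1) =
      Finset.univ.filter fun i : Fin N => i.val < m := by
    ext i
    rcases eq_or_ne i ⟨m, hm⟩ with rfl | hi
    · simp
    · simp [hi, signStep]
  rw [this, Fin.card_filter_val_lt, min_eq_right hm.le]

theorem nonempty_extFunctor_signStep_iso (k : Type u) [Field k] (N : ℕ) (d : ℤ) {m : ℕ}
    (hm : m ≤ N) :
    Nonempty ((IsAdmissible k N d).ι.op ⋙ extFunctor (boxes k (signStep N 0)) d ≅
      (IsAdmissible k N d).ι.op ⋙ extFunctor (boxes k (signStep N m)) (d + m)) := by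
  induction m with
  | zero => exact ⟨eqToIso (by simp)⟩
  | succ m ih =>
    obtain ⟨e⟩ := ih (by omega)
    have key := nonempty_extFunctor_iso
      (boxesShortComplex_shortExact (k := k) (signStep N m) ⟨m, hm⟩) (IsAdmissible k N d)
      (fun C hC i => (hC.1 i).projective)
      (show d + m + 1 = d + (m + 1 : ℕ) by push_cast; ring)
      -- The middle box has `m` entries `-1` and a `0` at place `m`. Its cohomology is needed in
      -- degrees `d + m` and `d + m + 1`, both within the vanishing range because `m < N`.
      (fun C hC => isZero_extFunctor_of_isAdmissible hC m (card_update_signStep_zero hm)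
        (Function.update_self _ _ _) le_rfl (by omega))
      (fun C hC => isZero_extFunctor_of_isAdmissible hC m (card_update_signStep_zero hm)
        (Function.update_self _ _ _) (by omega) (by omega))
    change Nonempty ((IsAdmissible k N d).ι.op ⋙
        extFunctor (boxes k (Function.update (signStep N m) ⟨m, hm⟩ 1)) (d + m) ≅
      (IsAdmissible k N d).ι.op ⋙ extFunctor
        (boxes k (Function.update (signStep N m) ⟨m, hm⟩ (-1))) (d + (m + 1 : ℕ))) at key
    rw [update_signStep_one, update_signStep_neg_one] at key
    exact key.map fun e' => e ≪≫ e'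

end Persistence

theorem mainTheorem1 (k : Type u) [Field k] (N : ℕ) (d : ℤ) :
    Nonempty (Persistence.dualOfHomology k N d ≅ Persistence.cohomologyOfGlobalDual k N d) := by
  open Persistence in
  obtain ⟨e⟩ := nonempty_extFunctor_signStep_iso k N d le_rfl
  -- The two ends of the chain of flips are the constant sign vectors, whose boxes represent the two
  -- duals.
  have h0 : signStep N 0 = fun _ => 1 := funext fun i => if_neg (Nat.not_lt_zero _)
  have h1 : signStep N N = fun _ => -1 := funext fun i => if_pos i.isLt
  rw [h0, h1] at e
  exact ⟨(Functor.isoWhiskerLeft (IsAdmissible k N d).ι.op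
      (Functor.isoWhiskerRight (dualComplexIso (homIntoBoxesOneIso k N)) _ ≪≫
        dualComplexHomologyIso (pointwiseDual k N) d)).symm ≪≫ e ≪≫
    Functor.isoWhiskerLeft (IsAdmissible k N d).ι.op
      (Functor.isoWhiskerRight (dualComplexIso (homIntoBoxesNegOneIso k N)) _)⟩
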